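/- Let $N\ge 1$, let $\varphi_i(y)=A_iy+b_i$ ($1\le i\le N$) be contractions of the Euclidean plane with $A_i\in GL_2(\mathbb{R})$ and $b_i\in\mathbb{R}^2$, and let $X\subset\mathbb{R}^2$ be the associated self-affine set, i.e. the unique non-empty compact set with $X=\bigcup_{i=1}^N\varphi_i(X)$. For a finite word $\mathtt{i}=i_1\cdots i_n$ over $\{1,\ldots,N\}$ write $|\mathtt{i}|=n$, $\varphi_{\mathtt{i}}=\varphi_{i_1}\circ\cdots\circ\varphi_{i_n}$, $A_{\mathtt{i}}=A_{i_1}\cdots A_{i_n}$ (the identity for the empty word), $\overleftarrow{\mathtt{i}}=i_n\cdots i_1$ and, if $n\ge1$, $\mathtt{i}^-=i_1\cdots i_{n-1}$. Let $\alpha_1(A)\ge\alpha_2(A)$ be the singular values of a matrix $A$, let $B(x,r)$ be the closed Euclidean ball, and $A+x=\{a+x\colon a\in A\}$. Assume that $X$ is dominated: there are $C>0$ and $0<\tau<1$ with $\alpha_2(A_{\mathtt{i}})\le C\tau^{|\mathtt{i}|}\alpha_1(A_{\mathtt{i}})$ for all finite words $\mathtt{i}$. Assume also that $X$ satisfies the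 weak bounded neighborhood condition: $\sup_{x\in X,\,r>0}\#\Phi(x,r)<\infty$, where $$\Phi(x,r)=\{\varphi_{\mathtt{i}}\colon |\mathtt{i}|\ge1,\ \alpha_2(A_{\mathtt{i}})\le r<\alpha_2(A_{\mathtt{i}^-})\text{ and }\varphi_{\mathtt{i}}(X)\cap B(x,r)\neq\emptyset\}$$ is a set of maps. Let $$X_F=\{\operatorname{im}(A)\colon A\in\overline{\{cA_{\overleftarrow{\mathtt{i}}}^{-1}\colon c\in\mathbb{R},\ \mathtt{i}\text{ a finite word}\}}\text{ has rank one}\},$$ where $A_{\overleftarrow{\mathtt{i}}}^{-1}=(A_{\overleftarrow{\mathtt{i}}})^{-1}$; it is a set of lines through the origin. A set $T\subset\mathbb{R}^2$ meeting the interior of $B(0,1)$ is a weak tangent of $X$ if there are $x_n\in X$ and $r_n>0$ with $r_n\to0$ such that $\frac{X-x_n}{r_n}\cap B(0,1)\to T$ in Hausdorff distance. Let $\dim_H$ denote the Hausdorff dimension, and let the Assouad dimension $\dim_A X$ be the infimum of all $s>0$ for which there is $C>0$ such that, for all $x\in X$ and $0<r<R$, the set $X\cap B(x,R)$ can be covered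 by at most $C(R/r)^s$ closed balls of radius $r$. Then for every weak tangent $T$ of $X$ there exist $x\in X$ and $V\in X_F$ such that $$\dim_H T\le 1+\dim_H(X\cap(V+x)).$$ In particular, $$\dim_A X\le 1+\sup_{x\in X,\ V\in X_F}\dim_H(X\cap(V+x)).$$ -/

import Mathlib

open Filter Topology Metric
open scoped NNReal ENNReal

noncomputable section

namespace SelfAffine

/-- The plane `ℝ²` with the Euclidean norm. -/
abbrev Plane : Type := EuclideanSpace ℝ (Fin 2)

/-- The translate `A + x = {a + x : a ∈ A}`. -/
def translate (A : Set Plane) (x : Plane) : Set Plane :=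
  (fun a => a + x) '' A

/-! ### Assouad dimension and weak tangents -/

/-- The Assouad dimension: the infimum of all `s > 0` for which there is `C > 0` such that for all
`x ∈ X` and `0 < r < R` the set `X ∩ B(x, R)` can be covered by at most `C (R / r) ^ s` closed balls
of radius `r` centred at points of the plane. -/
def assouadDim (X : Set Plane) : ℝ≥0∞ :=
  ⨅ (s : ℝ≥0) (_ : 0 < s ∧ ∃ C : ℝ≥0, 0 < C ∧ ∀ x ∈ X, ∀ r R : ℝ≥0, 0 < r → r < R →
      ((externalCoveringNumber r (X ∩ closedBall x R) : ℕ∞) : ℝ≥0∞)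
        ≤ ((C * (R / r) ^ (s : ℝ) : ℝ≥0) : ℝ≥0∞)),
    (s : ℝ≥0∞)

/-- The magnification `M_{x,r}(y) = (y - x) / r`, which takes `B(x, r)` to `B(0, 1)`. -/
def magnify (x : Plane) (r : ℝ) (y : Plane) : Plane :=
  r⁻¹ • (y - x)

/-- `T` is a weak tangent of `X`: it meets the interior of the closed unit ball `B(0, 1)`, and it is
the limit in Hausdorff distance of `M_{x_n, r_n}(X) ∩ B(0, 1)` for some points `x_n ∈ X` and some
positive radii `r_n → 0`. -/
def IsWeakTangent (X T : Set Plane) : Prop :=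
  (T ∩ interior (closedBall (0 : Plane) 1)).Nonempty ∧
  ∃ (x : ℕ → Plane) (r : ℕ → ℝ),
    (∀ n, x n ∈ X) ∧ (∀ n, 0 < r n) ∧ Tendsto r atTop (𝓝 0) ∧
    Tendsto (fun n => hausdorffEDist (magnify (x n) (r n) '' X ∩ closedBall (0 : Plane) 1) T)
      atTop (𝓝 0)

/-! ### Affine iterated function systems -/

/-- An affine IFS on the plane: `N` contractions `y ↦ A_i y + b_i` with `A_i` invertible. -/
structure AffineIFS (N : ℕ) where
  /-- The linear parts `A_i`. -/
  lin : Fin N → (Plane ≃L[ℝ] Plane)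
  /-- The translation parts `b_i`. -/
  trans : Fin N → Plane
  contracting : ∀ i, ∃ K : ℝ≥0, ContractingWith K (fun y => lin i y + trans i)

/-- The larger singular value `α₁(A)`. -/
def α₁ (A : Plane ≃L[ℝ] Plane) : ℝ :=
  (A : Plane →ₗ[ℝ] Plane).singularValues 0

/-- The smaller singular value `α₂(A)`. -/
def α₂ (A : Plane ≃L[ℝ] Plane) : ℝ :=
  (A : Plane →ₗ[ℝ] Plane).singularValues 1

namespace AffineIFS

variable {N : ℕ} (Φ : AffineIFS N)

/-- The `i`-th map `φ_i(y) = A_i y + b_i`. -/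
def map (i : Fin N) (y : Plane) : Plane :=
  Φ.lin i y + Φ.trans i

/-- `φ_w = φ_{i₁} ∘ ⋯ ∘ φ_{iₙ}` for a finite word `w = i₁ ⋯ iₙ`. -/
def wordMap : List (Fin N) → Plane → Plane
  | [] => id
  | i :: w => Φ.map i ∘ wordMap w

/-- `A_w = A_{i₁} ⋯ A_{iₙ}` for a finite word `w = i₁ ⋯ iₙ`. -/
def wordLin : List (Fin N) → (Plane ≃L[ℝ] Plane)
  | [] => ContinuousLinearEquiv.refl ℝ Plane
  | i :: w => (wordLin w).trans (Φ.lin i)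

/-- The linear part of `φ_w` is `A_w`. -/
theorem wordMap_sub (w : List (Fin N)) (y z : Plane) :
    Φ.wordMap w y - Φ.wordMap w z = Φ.wordLin w (y - z) := by
  induction w with
  | nil => simp [wordMap, wordLin]
  | cons i w ih => simp [wordMap, wordLin, map, ← ih]

/-- `X` is the self-affine set (limit set) of the IFS: the non-empty compact set which is the union
of its images `φ_i(X)`. -/
def IsLimitSet (X : Set Plane) : Prop :=
  X.Nonempty ∧ IsCompact X ∧ X = ⋃ i, Φ.map i '' X

/-- Domination: `α₂(A_w) ≤ C τ^|w| α₁(A_w)` for all finite words `w`. -/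
def IsDominated : Prop :=
  ∃ C τ : ℝ, 0 < C ∧ 0 < τ ∧ τ < 1 ∧
    ∀ w : List (Fin N), α₂ (Φ.wordLin w) ≤ C * τ ^ w.length * α₁ (Φ.wordLin w)

/-- The set `Φ(x, r)` of the maps (not words) `φ_w` with
`α₂(A_w) ≤ r < α₂(A_{w⁻})` and `φ_w(X) ∩ B(x, r) ≠ ∅`, where `w⁻` is the non-empty word `w`
without its last letter. -/
def neighborhood (X : Set Plane) (x : Plane) (r : ℝ) : Set (Plane → Plane) :=
  {f | ∃ w : List (Fin N), w ≠ [] ∧ f = Φ.wordMap w ∧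
    α₂ (Φ.wordLin w) ≤ r ∧ r < α₂ (Φ.wordLin w.dropLast) ∧
    (Φ.wordMap w '' X ∩ closedBall x r).Nonempty}

/-- The weak bounded neighbourhood condition: `#Φ(x, r)` is bounded uniformly over
`x ∈ X` and `r > 0`. -/
def WBNC (X : Set Plane) : Prop :=
  ∃ M : ℕ, ∀ x ∈ X, ∀ r : ℝ, 0 < r → (Φ.neighborhood X x r).encard ≤ M

/-- The set `X_F` of backward Furstenberg directions: the lines through the origin which are images
of rank one maps in the closure of `{c (A_{w reversed})⁻¹ : c ∈ ℝ, w a finite word}`. -/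
def backwardFurstenberg : Set (Submodule ℝ Plane) :=
  {V | ∃ B ∈ closure {B : Plane →L[ℝ] Plane | ∃ (c : ℝ) (w : List (Fin N)),
          B = c • ((Φ.wordLin w.reverse).symm : Plane →L[ℝ] Plane)},
        Module.finrank ℝ (LinearMap.range (B : Plane →ₗ[ℝ] Plane)) = 1 ∧
        V = LinearMap.range (B : Plane →ₗ[ℝ] Plane)}

end AffineIFS

end SelfAffine

end

/-!
Let `T` be a weak tangent along `x n`, `r n`. By the weak bounded neighbourhood condition,
`X ∩ B(x n, r n)` is covered by boundedly many cylinders `φ_w(X)` with `α₂(A_w)` comparable to `r n`.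
For one such choice of words `w n`, the maps `r n • A_{w n}⁻¹` are bounded, have norm at least one,
and by domination collapse some unit vector in the limit; so they have a rank one limit `B` whose
range is a backward Furstenberg direction `V` (`AffineIFS.exists_rank_one_limit`). Pulling the points
of the tangent back through `φ_{w n}` gives, in the limit, a map from the corresponding part of `T`
into a slice `X ∩ (V + y)` with increments `t - t' ↦ B (t - t')`. That part of `T` therefore lies in
a bounded tube over the slice, and such a tube adds at most one to the Hausdorff dimension
(`dimH_le_one_add_dimH`). As `T` is a finite union of such parts, some slice bounds `dimH T`
(`AffineIFS.exists_dimH_weakTangent_le`). All limits of bounded sequences are taken along one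
non-principal ultrafilter, which replaces the passages to subsequences.

For the Assouad dimension, let `s` be larger than `dimH T` for every weak tangent `T`. A compact weak
tangent is covered by finitely many balls with small `∑ radius ^ s`, and this cover persists at the
scales converging to it. By compactness of the hyperspace of the unit ball, all balls `B(x, R)` of
small radius admit such covers with relative radii uniformly bounded below
(`assouadDim_le_of_forall_weakTangent`). Iterating the covers down to radius `r` bounds the covering
number of `X ∩ B(x, R)` by a multiple of `(R / r) ^ s` (`exists_finset_cover_of_efficientCover`).
-/

open MeasureTheory Set

/-! ### Hausdorff dimension of tubes -/

namespace SelfAffine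

theorem exists_ball_cover_of_hausdorffMeasure_eq_zero {E : Type*} [MetricSpace E] [Nonempty E]
    [MeasurableSpace E] [BorelSpace E] {s : ℝ} (hs : 0 < s) {A : Set E}
    (hA : μH[s] A = 0) {ε : ℝ≥0∞} (hε : 0 < ε) :
    ∃ (c : ℕ → E) (r : ℕ → ℝ), (∀ n, 0 < r n) ∧ A ⊆ ⋃ n, ball (c n) (r n) ∧
      ∑' n, ENNReal.ofReal (r n) ^ s < ε := by
  obtain ⟨η, hη0, hηε⟩ := exists_between hε
  rw [Measure.hausdorffMeasure_apply] at hA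
  have h1 := (ENNReal.iSup_eq_zero.1 ((ENNReal.iSup_eq_zero.1 hA) 1)) one_pos
  have h2 : (⨅ (t : ℕ → Set E) (_ : A ⊆ ⋃ n, t n) (_ : ∀ n, ediam (t n) ≤ 1),
      ∑' n, ⨆ _ : (t n).Nonempty, ediam (t n) ^ s) < η := by rw [h1]; exact hη0
  simp only [iInf_lt_iff] at h2
  obtain ⟨t, hcov, hd, hsum⟩ := h2
  -- The diameters are enlarged slightly, so that sets of diameter zero also lie in open balls.
  obtain ⟨δ, hδ0, hδ⟩ := ENNReal.exists_pos_sum_of_countable' (tsub_pos_of_lt hηε).ne' ℕ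
  have hr : ∀ n, ∃ r : ℝ, 0 < r ∧ ediam (t n) < ENNReal.ofReal r ∧
      ENNReal.ofReal r ^ s < ediam (t n) ^ s + δ n := by
    intro n
    have hfin : ediam (t n) ≠ ⊤ := ne_top_of_le_ne_top ENNReal.one_ne_top (hd n)
    set d := (ediam (t n)).toReal with hdd
    have hd' : ediam (t n) = ENNReal.ofReal d := (ENNReal.ofReal_toReal hfin).symm
    have hcont : Tendsto (fun x : ℝ => ENNReal.ofReal x ^ s) (𝓝[>] d) (𝓝 (ENNReal.ofReal d ^ s)) :=
      (((ENNReal.continuous_rpow_const).comp ENNReal.continuous_ofReal).tendsto d).mono_left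
        nhdsWithin_le_nhds
    have hlt : ENNReal.ofReal d ^ s < ENNReal.ofReal d ^ s + δ n :=
      ENNReal.lt_add_right (ENNReal.rpow_ne_top_of_nonneg hs.le ENNReal.ofReal_ne_top) (hδ0 n).ne'
    obtain ⟨r, hr1, hr2⟩ := ((hcont.eventually_lt_const hlt).and self_mem_nhdsWithin).exists
    have hr0 : 0 < r := lt_of_le_of_lt ENNReal.toReal_nonneg hr2
    exact ⟨r, hr0, by rw [hd']; exact (ENNReal.ofReal_lt_ofReal_iff hr0).2 hr2, by rw [hd']; exact hr1⟩
  choose r hr0 hrd hrs using hr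
  have hc : ∀ n, ∃ c : E, t n ⊆ ball c (r n) := by
    intro n
    rcases (t n).eq_empty_or_nonempty with h | ⟨c, hc⟩
    · exact ⟨Classical.arbitrary E, by simp [h]⟩
    · refine ⟨c, fun x hx => ?_⟩
      have := (edist_le_ediam_of_mem hx hc).trans_lt (hrd n)
      rw [edist_dist] at this
      exact (ENNReal.ofReal_lt_ofReal_iff (hr0 n)).1 this
  choose c hc using hc
  refine ⟨c, r, hr0, hcov.trans (iUnion_mono hc), ?_⟩
  have hdiam : ∀ n, ediam (t n) ^ s = ⨆ _ : (t n).Nonempty, ediam (t n) ^ s := by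
    intro n
    rcases (t n).eq_empty_or_nonempty with h | h
    · simp [h, hs]
    · simp [h]
  calc ∑' n, ENNReal.ofReal (r n) ^ s ≤ ∑' n, (ediam (t n) ^ s + δ n) :=
        ENNReal.tsum_le_tsum fun n => (hrs n).le
    _ = ∑' n, ediam (t n) ^ s + ∑' n, δ n := ENNReal.tsum_add
    _ < η + (ε - η) := by
        refine ENNReal.add_lt_add ?_ hδ
        simpa only [← hdiam] using hsum
    _ = ε := add_tsub_cancel_of_le hηε.le

theorem hausdorffMeasure_eq_zero_of_forall_cover {E : Type*} [MetricSpace E]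
    [MeasurableSpace E] [BorelSpace E] {s : ℝ} (hs : 0 < s) {A : Set E}
    (h : ∀ ε : ℝ≥0∞, 0 < ε → ∃ (ι : Type) (_ : Countable ι) (t : ι → Set E), A ⊆ ⋃ i, t i ∧
      ∑' i, ediam (t i) ^ s ≤ ε) :
    μH[s] A = 0 := by
  choose ι hι t hcov hsum using fun n : ℕ => h ((n : ℝ≥0∞) + 1)⁻¹ (by simp)
  have hlim : Tendsto (fun n : ℕ => ((n : ℝ≥0∞) + 1)⁻¹) atTop (𝓝 0) := by
    simpa using (tendsto_add_atTop_iff_nat 1).2 ENNReal.tendsto_inv_nat_nhds_zero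
  have hr : Tendsto (fun n : ℕ => (((n : ℝ≥0∞) + 1)⁻¹) ^ s⁻¹) atTop (𝓝 0) := by
    have := (ENNReal.continuous_rpow_const (y := s⁻¹)).tendsto 0
    rw [ENNReal.zero_rpow_of_pos (inv_pos.2 hs)] at this
    exact this.comp hlim
  have key := Measure.hausdorffMeasure_le_liminf_tsum s A _ hr t
    (Eventually.of_forall fun n i => ?_) (Eventually.of_forall hcov)
  · refine le_antisymm (key.trans ?_) zero_le
    exact (liminf_le_liminf (Eventually.of_forall hsum)).trans hlim.liminf_eq.le
  · have h1 := (ENNReal.le_tsum i).trans (hsum n)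
    have h2 := ENNReal.rpow_le_rpow h1 (inv_pos.2 hs).le
    rwa [← ENNReal.rpow_mul, mul_inv_cancel₀ hs.ne', ENNReal.rpow_one] at h2

/-- A set `S` with a bounded real coordinate `f` and a second coordinate `g` in `A`, which jointly
control distances, has dimension at most `1 + dimH A`: over a ball of radius `r` meeting `A`, the set
`S` is cut into `O(1 / r)` pieces of diameter `O(r)`. -/
theorem dimH_le_one_add_dimH {E Y : Type*} [MetricSpace E] [MetricSpace Y] {S : Set E} {A : Set Y}
    {f : E → ℝ} {g : E → Y} {K : ℝ} (hK : 0 < K)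
    (hfg : ∀ z ∈ S, ∀ w ∈ S, dist z w ≤ K * max |f z - f w| (dist (g z) (g w)))
    (hf : ∀ z ∈ S, f z ∈ Icc (0 : ℝ) 1) (hg : MapsTo g S A) :
    dimH S ≤ 1 + dimH A := by
  borelize E
  borelize Y
  rcases isEmpty_or_nonempty Y with hY | hY
  · have : S = ∅ := eq_empty_of_forall_notMem fun z _ => hY.elim (g z)
    simp [this]
  refine ENNReal.le_of_forall_pos_le_add fun ε hε hfin => ?_
  have hA : dimH A ≠ ⊤ := fun h => by simp [h] at hfin
  obtain ⟨a, ha⟩ : ∃ a : ℝ≥0, dimH A = a := ⟨(dimH A).toNNReal, (ENNReal.coe_toNNReal hA).symm⟩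
  set d : ℝ≥0 := a + ε with hd
  have hd0 : 0 < d := by positivity
  have h0 : μH[(d : ℝ)] A = 0 := hausdorffMeasure_of_dimH_lt (by
    rw [ha]; exact_mod_cast lt_add_of_pos_right a hε)
  suffices hS : μH[((1 + d : ℝ≥0) : ℝ)] S = 0 by
    have := dimH_le_of_hausdorffMeasure_ne_top (d := 1 + d) (by rw [hS]; simp)
    rw [ha]
    calc dimH S ≤ ((1 + d : ℝ≥0) : ℝ≥0∞) := this
      _ = 1 + (a : ℝ≥0∞) + ε := by rw [hd]; push_cast; ring
  refine hausdorffMeasure_eq_zero_of_forall_cover (by positivity) fun η hη => ?_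
  set Q : ℝ≥0∞ := 2 * ENNReal.ofReal (2 * K) ^ ((1 : ℝ) + d) with hQ
  have hQtop : Q ≠ ⊤ := ENNReal.mul_ne_top (by simp)
    (ENNReal.rpow_ne_top_of_nonneg (by positivity) ENNReal.ofReal_ne_top)
  have hQ0 : Q ≠ 0 := by
    simp only [hQ, ne_eq, mul_eq_zero, not_or]
    exact ⟨by simp, (ENNReal.rpow_pos (by simpa using hK) ENNReal.ofReal_ne_top).ne'⟩
  obtain ⟨c, r, hr0, hcov, hsum⟩ := exists_ball_cover_of_hausdorffMeasure_eq_zero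
    (NNReal.coe_pos.2 hd0) h0 (ε := min 1 (η / Q))
    (lt_min one_pos (ENNReal.div_pos hη.ne' hQtop))
  -- The bound `1` on the sum keeps the radii at most `1`, so that `⌊1 / r n⌋₊ + 1 ≤ 2 / r n`.
  have hr1 : ∀ n, r n ≤ 1 := by
    intro n
    have h1 := ((ENNReal.le_tsum n).trans_lt hsum).le.trans (min_le_left _ _)
    by_contra hcon
    push Not at hcon
    have h2 : (1 : ℝ≥0∞) < ENNReal.ofReal (r n) := by
      rw [← ENNReal.ofReal_one]; exact (ENNReal.ofReal_lt_ofReal_iff (hr0 n)).2 hcon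
    exact absurd h1 (not_le.2 (ENNReal.one_lt_rpow h2 (NNReal.coe_pos.2 hd0)))
  refine ⟨Σ n : ℕ, Fin (⌊1 / r n⌋₊ + 1), inferInstance,
    fun p => {z ∈ S | g z ∈ ball (c p.1) (r p.1) ∧ ⌊f z / r p.1⌋₊ = p.2}, ?_, ?_⟩
  · intro z hz
    obtain ⟨n, hn⟩ := mem_iUnion.1 (hcov (hg hz))
    refine mem_iUnion.2 ⟨⟨n, ⟨⌊f z / r n⌋₊, Nat.lt_succ_of_le (Nat.floor_le_floor ?_)⟩⟩, hz, hn, rfl⟩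
    have := (hf z hz).2
    have := (hr0 n).le
    gcongr
  · have hdiam : ∀ p : (Σ n : ℕ, Fin (⌊1 / r n⌋₊ + 1)),
        ediam {z ∈ S | g z ∈ ball (c p.1) (r p.1) ∧ ⌊f z / r p.1⌋₊ = p.2} ≤
          ENNReal.ofReal (2 * K) * ENNReal.ofReal (r p.1) := by
      rintro ⟨n, k⟩
      refine ediam_le fun z hz w hw => ?_
      rw [← ENNReal.ofReal_mul (by positivity), edist_dist]
      refine ENNReal.ofReal_le_ofReal ((hfg z hz.1 w hw.1).trans ?_)
      have hrn := hr0 n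
      rw [mul_comm 2 K, mul_assoc]
      refine mul_le_mul_of_nonneg_left (max_le ?_ ?_) hK.le
      · have e1 := Nat.floor_le (div_nonneg (hf z hz.1).1 hrn.le)
        have e2 := Nat.lt_floor_add_one (f z / r n)
        have e3 := Nat.floor_le (div_nonneg (hf w hw.1).1 hrn.le)
        have e4 := Nat.lt_floor_add_one (f w / r n)
        simp only [hz.2.2, hw.2.2] at e1 e2 e3 e4
        have e5 : |f z / r n - f w / r n| ≤ 1 := abs_le.2 ⟨by linarith, by linarith⟩
        rw [← sub_div, abs_div, abs_of_pos hrn, div_le_one hrn] at e5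
        linarith
      · have := dist_triangle_right (g z) (g w) (c n)
        have h1 := mem_ball.1 hz.2.1
        have h2 := mem_ball.1 hw.2.1
        linarith
    calc _ ≤ ∑' p : (Σ n : ℕ, Fin (⌊1 / r n⌋₊ + 1)),
          (ENNReal.ofReal (2 * K) * ENNReal.ofReal (r p.1)) ^ (((1 + d : ℝ≥0)) : ℝ) :=
          ENNReal.tsum_le_tsum fun p => ENNReal.rpow_le_rpow (hdiam p) (by positivity)
      _ = ∑' n, ((⌊1 / r n⌋₊ + 1 : ℕ) : ℝ≥0∞) *
          (ENNReal.ofReal (2 * K) * ENNReal.ofReal (r n)) ^ ((1 : ℝ) + d) := by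
          rw [ENNReal.tsum_sigma']
          simp [tsum_fintype]
      _ ≤ ∑' n, Q * ENNReal.ofReal (r n) ^ (d : ℝ) := by
          refine ENNReal.tsum_le_tsum fun n => ?_
          have hrn := hr0 n
          have hk : ((⌊1 / r n⌋₊ + 1 : ℕ) : ℝ≥0∞) * ENNReal.ofReal (r n) ≤ 2 := by
            have e : ((⌊1 / r n⌋₊ + 1 : ℕ) : ℝ) * r n ≤ 2 := by
              have := Nat.floor_le (one_div_pos.2 hrn).le
              push_cast
              calc ((⌊1 / r n⌋₊ : ℝ) + 1) * r n ≤ (1 / r n + 1) * r n := by gcongr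
                _ = 1 + r n := by field_simp
                _ ≤ 2 := by linarith [hr1 n]
            rw [← ENNReal.ofReal_natCast, ← ENNReal.ofReal_mul (by positivity)]
            calc _ ≤ ENNReal.ofReal 2 := ENNReal.ofReal_le_ofReal e
              _ = 2 := by simp
          rw [ENNReal.mul_rpow_of_nonneg _ _ (by positivity),
            ENNReal.rpow_add (x := ENNReal.ofReal (r n)) 1 _ (by simpa using hrn)
              ENNReal.ofReal_ne_top, ENNReal.rpow_one]
          calc _ = (((⌊1 / r n⌋₊ + 1 : ℕ) : ℝ≥0∞) * ENNReal.ofReal (r n)) *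
                (ENNReal.ofReal (2 * K) ^ ((1 : ℝ) + d) * ENNReal.ofReal (r n) ^ (d : ℝ)) := by ring
            _ ≤ 2 * (ENNReal.ofReal (2 * K) ^ ((1 : ℝ) + d) * ENNReal.ofReal (r n) ^ (d : ℝ)) := by
                gcongr
            _ = _ := by rw [hQ]; ring
      _ = Q * ∑' n, ENNReal.ofReal (r n) ^ (d : ℝ) := ENNReal.tsum_mul_left
      _ ≤ Q * (η / Q) := by gcongr; exact hsum.le.trans (min_le_right _ _)
      _ = η := ENNReal.mul_div_cancel hQ0 hQtop

end SelfAffine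

/-! ### Singular values and cylinders -/

namespace SelfAffine

/-- The singular value decomposition of `‖A x‖ ^ 2`, in an orthonormal eigenbasis of `A* A`. -/
theorem sq_norm_apply_eq_sum_singularValues (A : Plane →ₗ[ℝ] Plane) (x : Plane) :
    ‖A x‖ ^ 2 = ∑ i : Fin 2, A.singularValues i ^ 2 *
      ((A.isSymmetric_adjoint_comp_self.eigenvectorBasis finrank_euclideanSpace_fin).repr x i) ^ 2 := by
  set hT := A.isSymmetric_adjoint_comp_self
  set b := hT.eigenvectorBasis finrank_euclideanSpace_fin with hb
  have h1 : ‖A x‖ ^ 2 = inner ℝ x ((A.adjoint ∘ₗ A) x) := by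
    rw [LinearMap.comp_apply, LinearMap.adjoint_inner_right, real_inner_self_eq_norm_sq]
  rw [h1, ← b.sum_inner_mul_inner]
  refine Finset.sum_congr rfl fun i _ => ?_
  rw [← hT (b i) x, hT.apply_eigenvectorBasis, ← A.sq_singularValues_fin, inner_smul_left,
    b.repr_apply_apply, real_inner_comm]
  simp
  ring

theorem norm_apply_eigenvectorBasis_adjoint_comp_self (A : Plane →ₗ[ℝ] Plane) (i : Fin 2) :
    ‖A (A.isSymmetric_adjoint_comp_self.eigenvectorBasis finrank_euclideanSpace_fin i)‖ =
      A.singularValues i := by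
  have h := sq_norm_apply_eq_sum_singularValues A
    (A.isSymmetric_adjoint_comp_self.eigenvectorBasis finrank_euclideanSpace_fin i)
  rw [← abs_of_nonneg (norm_nonneg _), ← abs_of_nonneg (A.singularValues_nonneg i),
    ← sq_eq_sq_iff_abs_eq_abs, h]
  fin_cases i <;> simp [OrthonormalBasis.repr_self]

theorem exists_norm_apply_eq_α₁ (A : Plane ≃L[ℝ] Plane) : ∃ u : Plane, ‖u‖ = 1 ∧ ‖A u‖ = α₁ A :=
  ⟨_, OrthonormalBasis.norm_eq_one _ _,
    norm_apply_eigenvectorBasis_adjoint_comp_self (A : Plane →ₗ[ℝ] Plane) 0⟩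

theorem exists_norm_apply_eq_α₂ (A : Plane ≃L[ℝ] Plane) : ∃ u : Plane, ‖u‖ = 1 ∧ ‖A u‖ = α₂ A :=
  ⟨_, OrthonormalBasis.norm_eq_one _ _,
    norm_apply_eigenvectorBasis_adjoint_comp_self (A : Plane →ₗ[ℝ] Plane) 1⟩

theorem α₂_mul_norm_le (A : Plane ≃L[ℝ] Plane) (x : Plane) : α₂ A * ‖x‖ ≤ ‖A x‖ := by
  set T := (A : Plane →ₗ[ℝ] Plane)
  have h := sq_norm_apply_eq_sum_singularValues T x
  have hanti : T.singularValues 1 ≤ T.singularValues 0 := T.singularValues_antitone zero_le_one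
  have h1 := T.singularValues_nonneg 1
  set b := T.isSymmetric_adjoint_comp_self.eigenvectorBasis finrank_euclideanSpace_fin
  have hx : ‖x‖ ^ 2 = ∑ i, (b.repr x i) ^ 2 := by
    rw [← b.repr.norm_map, EuclideanSpace.real_norm_sq_eq]
  rw [Fin.sum_univ_two] at h hx
  refine le_of_sq_le_sq ?_ (norm_nonneg _)
  change (T.singularValues 1 * ‖x‖) ^ 2 ≤ ‖T x‖ ^ 2
  rw [h, mul_pow, hx]
  have : T.singularValues 1 ^ 2 ≤ T.singularValues 0 ^ 2 := by gcongr
  have h3 := mul_le_mul_of_nonneg_right this (sq_nonneg (b.repr x 0))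
  simp only [Fin.val_zero, Fin.val_one, mul_add] at h3 ⊢
  linarith

theorem α₂_pos (A : Plane ≃L[ℝ] Plane) : 0 < α₂ A := by
  obtain ⟨u, hu, h⟩ := exists_norm_apply_eq_α₂ A
  rw [← h, norm_pos_iff]
  intro h0
  simp [(map_eq_zero_iff A A.injective).1 h0] at hu

theorem α₁_pos (A : Plane ≃L[ℝ] Plane) : 0 < α₁ A := by
  obtain ⟨u, hu, h⟩ := exists_norm_apply_eq_α₁ A
  rw [← h, norm_pos_iff]
  intro h0
  simp [(map_eq_zero_iff A A.injective).1 h0] at hu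

theorem α₂_le_of_forall_norm_le {A : Plane ≃L[ℝ] Plane} {K : ℝ} (h : ∀ x, ‖A x‖ ≤ K * ‖x‖) :
    α₂ A ≤ K := by
  obtain ⟨u, hu, hA⟩ := exists_norm_apply_eq_α₂ A
  simpa [hA, hu] using h u

theorem le_α₂_of_forall_le_norm {A : Plane ≃L[ℝ] Plane} {K : ℝ} (h : ∀ x, K * ‖x‖ ≤ ‖A x‖) :
    K ≤ α₂ A := by
  obtain ⟨u, hu, hA⟩ := exists_norm_apply_eq_α₂ A
  simpa [hA, hu] using h u

theorem α₂_mul_α₂_le_trans (A B : Plane ≃L[ℝ] Plane) : α₂ A * α₂ B ≤ α₂ (A.trans B) :=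
  le_α₂_of_forall_le_norm fun x => calc
    α₂ A * α₂ B * ‖x‖ = α₂ B * (α₂ A * ‖x‖) := by ring
    _ ≤ α₂ B * ‖A x‖ := by gcongr; exacts [(α₂_pos B).le, α₂_mul_norm_le A x]
    _ ≤ ‖B (A x)‖ := α₂_mul_norm_le B (A x)

namespace AffineIFS

variable {N : ℕ} (Φ : AffineIFS N)

theorem wordMap_append_singleton (w : List (Fin N)) (i : Fin N) :
    Φ.wordMap (w ++ [i]) = Φ.wordMap w ∘ Φ.map i := by
  induction w with
  | nil => rfl
  | cons j w ih => simp only [List.cons_append, wordMap, ih]; rfl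

theorem wordLin_append_singleton (w : List (Fin N)) (i : Fin N) :
    Φ.wordLin (w ++ [i]) = (Φ.lin i).trans (Φ.wordLin w) := by
  induction w with
  | nil => rfl
  | cons j w ih => simp only [List.cons_append, wordLin, ih]; rfl

theorem exists_contraction_bound [NeZero N] :
    ∃ K : ℝ, 0 ≤ K ∧ K < 1 ∧ ∀ i x, ‖Φ.lin i x‖ ≤ K * ‖x‖ := by
  choose k hk using Φ.contracting
  obtain ⟨i₀, h₀⟩ := Finite.exists_max k
  refine ⟨k i₀, (k i₀).2, mod_cast (hk i₀).1, fun i x => ?_⟩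
  have h := (hk i).2.dist_le_mul x 0
  simp only [map_zero, zero_add, dist_eq_norm, add_sub_cancel_right, sub_zero] at h
  refine h.trans ?_
  gcongr
  exact_mod_cast h₀ i

theorem norm_wordLin_le {K : ℝ} (hK : 0 ≤ K) (h : ∀ i x, ‖Φ.lin i x‖ ≤ K * ‖x‖)
    (w : List (Fin N)) (x : Plane) : ‖Φ.wordLin w x‖ ≤ K ^ w.length * ‖x‖ := by
  induction w with
  | nil => simp [wordLin]
  | cons i w ih => calc
      ‖Φ.lin i (Φ.wordLin w x)‖ ≤ K * ‖Φ.wordLin w x‖ := h i _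
      _ ≤ K * (K ^ w.length * ‖x‖) := by gcongr
      _ = K ^ (i :: w).length * ‖x‖ := by rw [List.length_cons]; ring

theorem exists_α₂_lower_bound [NeZero N] :
    ∃ c : ℝ, 0 < c ∧ c < 1 ∧ ∀ i, c ≤ α₂ (Φ.lin i) := by
  obtain ⟨i₀, h₀⟩ := Finite.exists_min fun i => α₂ (Φ.lin i)
  obtain ⟨K, -, hK1, hK⟩ := Φ.exists_contraction_bound
  exact ⟨α₂ (Φ.lin i₀), α₂_pos _, (α₂_le_of_forall_norm_le (hK i₀)).trans_lt hK1, h₀⟩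

theorem mul_α₂_dropLast_le {c : ℝ} (h : ∀ i, c ≤ α₂ (Φ.lin i)) {w : List (Fin N)} (hw : w ≠ []) :
    c * α₂ (Φ.wordLin w.dropLast) ≤ α₂ (Φ.wordLin w) := by
  conv_rhs => rw [← List.dropLast_append_getLast hw, wordLin_append_singleton]
  exact (mul_le_mul_of_nonneg_right (h _) (α₂_pos _).le).trans (α₂_mul_α₂_le_trans _ _)

theorem pow_length_le_α₂ {c : ℝ} (hc : 0 ≤ c) (h : ∀ i, c ≤ α₂ (Φ.lin i)) (w : List (Fin N)) :
    c ^ w.length ≤ α₂ (Φ.wordLin w) := by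
  induction w with
  | nil =>
    refine le_α₂_of_forall_le_norm fun x => ?_
    simp [wordLin]
  | cons i w ih =>
    rw [List.length_cons, pow_succ]
    exact (mul_le_mul ih (h i) hc (α₂_pos _).le).trans (α₂_mul_α₂_le_trans _ _)

/-- Every point of `X` lies in a cylinder whose smaller singular value has just dropped to `r`
or below. -/
theorem exists_mem_wordMap_image_of_lt_one [NeZero N] {X : Set Plane}
    (hX : X = ⋃ i, Φ.map i '' X) {y : Plane} (hy : y ∈ X) {r : ℝ} (hr0 : 0 < r) (hr1 : r < 1) :
    ∃ w : List (Fin N), w ≠ [] ∧ α₂ (Φ.wordLin w) ≤ r ∧ r < α₂ (Φ.wordLin w.dropLast) ∧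
      y ∈ Φ.wordMap w '' X := by
  by_contra! hcon
  obtain ⟨K, hK0, hK1, hK⟩ := Φ.exists_contraction_bound
  have key : ∀ n : ℕ, ∃ w : List (Fin N), w.length = n ∧ r < α₂ (Φ.wordLin w) ∧
      y ∈ Φ.wordMap w '' X := by
    intro n
    induction n with
    | zero =>
      refine ⟨[], rfl, hr1.trans_le ?_, y, hy, rfl⟩
      exact le_α₂_of_forall_le_norm fun x => by simp [wordLin]
    | succ n ih =>
      obtain ⟨w, hwn, hwr, x, hx, rfl⟩ := ih
      rw [hX] at hx
      obtain ⟨i, x', hx', rfl⟩ := mem_iUnion.1 hx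
      have hmem : Φ.wordMap w (Φ.map i x') ∈ Φ.wordMap (w ++ [i]) '' X :=
        ⟨x', hx', by rw [wordMap_append_singleton]; rfl⟩
      refine ⟨w ++ [i], by simp [hwn], ?_, hmem⟩
      by_contra! hle
      exact hcon (w ++ [i]) (by simp) hle (by simpa using hwr) hmem
  obtain ⟨n, hn⟩ := exists_pow_lt_of_lt_one hr0 hK1
  obtain ⟨w, hwn, hwr, -⟩ := key n
  have := α₂_le_of_forall_norm_le (Φ.norm_wordLin_le hK0 hK w)
  rw [hwn] at this
  linarith

end AffineIFS

end SelfAffine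

/-! ### Weak tangents of dominated self-affine sets -/

namespace SelfAffine

/-- A subset of the unit ball which is mapped into `A` with increments given by a rank one map `B` has
dimension at most `1 + dimH A`: the coordinate along `ker B` is the bounded one. -/
theorem dimH_le_one_add_dimH_of_rank_one {B : Plane →L[ℝ] Plane}
    (hB : Module.finrank ℝ (LinearMap.range (B : Plane →ₗ[ℝ] Plane)) = 1) {S A : Set Plane}
    (hS : S ⊆ closedBall 0 1) {g : Plane → Plane}
    (hg : ∀ z ∈ S, ∀ w ∈ S, g z - g w = B (z - w)) (hmaps : MapsTo g S A) :
    dimH S ≤ 1 + dimH A := by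
  have hker : Module.finrank ℝ (LinearMap.ker (B : Plane →ₗ[ℝ] Plane)) = 1 := by
    have h := (B : Plane →ₗ[ℝ] Plane).finrank_range_add_finrank_ker
    rw [hB, finrank_euclideanSpace_fin] at h
    omega
  obtain ⟨⟨v, hvB⟩, hv0, hv⟩ := finrank_eq_one_iff'.1 hker
  have hv0' : v ≠ 0 := fun h => hv0 (Subtype.ext h)
  set u : Plane := ‖v‖⁻¹ • v with hu
  have hu1 : ‖u‖ = 1 := by
    rw [hu, norm_smul, norm_inv, norm_norm, inv_mul_cancel₀ (norm_ne_zero_iff.2 hv0')]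
  have hinj : LinearMap.ker
      (((innerSL ℝ u).prod B : Plane →L[ℝ] ℝ × Plane) : Plane →ₗ[ℝ] ℝ × Plane) = ⊥ := by
    rw [LinearMap.ker_eq_bot']
    intro z hz
    have hz1 : inner ℝ u z = 0 := congrArg Prod.fst hz
    have hz2 : B z = 0 := congrArg Prod.snd hz
    obtain ⟨a, ha⟩ := hv ⟨z, hz2⟩
    have ha' : a • v = z := congrArg Subtype.val ha
    rw [← ha', hu, inner_smul_left, inner_smul_right, real_inner_self_eq_norm_sq] at hz1
    have : a = 0 := by
      have : ‖v‖ ≠ 0 := norm_ne_zero_iff.2 hv0'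
      simpa [this, hv0'] using hz1
    rw [← ha', this, zero_smul]
  obtain ⟨K, hK0, hK⟩ := LinearMap.exists_antilipschitzWith _ hinj
  refine dimH_le_one_add_dimH (f := fun z => (inner ℝ u z + 1) / 2) (g := g) (K := 2 * K)
    (by positivity) (fun z hz w hw => ?_) (fun z hz => ?_) hmaps
  · have h := hK.le_mul_dist z w
    rw [Prod.dist_eq] at h
    change dist z w ≤ K * max (dist (inner ℝ u z) (inner ℝ u w)) (dist (B z) (B w)) at h
    refine h.trans ?_
    rw [mul_comm 2 (K : ℝ), mul_assoc, dist_eq_norm (g z), hg z hz w hw, map_sub, ← dist_eq_norm]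
    gcongr
    rw [mul_max_of_nonneg _ _ zero_le_two]
    refine max_le_max ?_ (by linarith [dist_nonneg (x := B z) (y := B w)])
    rw [← sub_div, add_sub_add_right_eq_sub, abs_div, Real.dist_eq, abs_two]
    linarith
  · have h1 := abs_real_inner_le_norm u z
    have h2 : ‖z‖ ≤ 1 := by simpa using hS hz
    rw [hu1, one_mul] at h1
    have h3 := abs_le.1 (h1.trans h2)
    constructor <;> linarith

theorem tendsto_clm_apply {α : Type*} {l : Filter α} {L : α → Plane →L[ℝ] Plane} {q : α → Plane}
    {B : Plane →L[ℝ] Plane} {a : Plane} (hL : Tendsto L l (𝓝 B)) (hq : Tendsto q l (𝓝 a)) :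
    Tendsto (fun n => L n (q n)) l (𝓝 (B a)) :=
  (isBoundedBilinearMap_apply.continuous.tendsto (B, a)).comp (hL.prodMk_nhds hq)

/-- Sequences in a compact set converge along every ultrafilter. -/
theorem exists_tendsto_of_eventually_mem {E : Type*} [TopologicalSpace E] {K : Set E}
    (hK : IsCompact K) {U : Ultrafilter ℕ} {p : ℕ → E} (hp : ∀ᶠ n in (U : Filter ℕ), p n ∈ K) :
    ∃ a ∈ K, Tendsto p U (𝓝 a) :=
  hK.ultrafilter_le_nhds (U.map p) (le_principal_iff.2 hp)

namespace AffineIFS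

variable {N : ℕ} {Φ : AffineIFS N}

/-- Along words with `α₂(A_w)` comparable to `r`, the maps `r • A_w⁻¹` converge to a rank one map:
they are bounded since `α₂(A_w) ≥ c r`, do not degenerate since `α₂(A_w) ≤ r`, and contract a unit
vector by `r / α₁(A_w)`, which tends to zero by domination. -/
theorem exists_rank_one_limit [NeZero N] (hdom : Φ.IsDominated) {U : Ultrafilter ℕ}
    {w : ℕ → List (Fin N)} {r : ℕ → ℝ} (hr0 : ∀ n, 0 < r n) (hr : Tendsto r U (𝓝 0)) {c : ℝ}
    (hc : 0 < c)
    (hw : ∀ᶠ n in (U : Filter ℕ),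
      c * r n ≤ α₂ (Φ.wordLin (w n)) ∧ α₂ (Φ.wordLin (w n)) ≤ r n) :
    ∃ B : Plane →L[ℝ] Plane,
      Tendsto (fun n => r n • ((Φ.wordLin (w n)).symm : Plane →L[ℝ] Plane)) U (𝓝 B) ∧
      Module.finrank ℝ (LinearMap.range (B : Plane →ₗ[ℝ] Plane)) = 1 := by
  set L : ℕ → (Plane →L[ℝ] Plane) :=
    fun n => r n • ((Φ.wordLin (w n)).symm : Plane →L[ℝ] Plane) with hL
  have hLA : ∀ n x, L n (Φ.wordLin (w n) x) = r n • x := fun n x => by simp [hL]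
  have hbound : ∀ᶠ n in (U : Filter ℕ), L n ∈ closedBall (0 : Plane →L[ℝ] Plane) c⁻¹ := by
    filter_upwards [hw] with n hn
    rw [mem_closedBall_zero_iff]
    refine ContinuousLinearMap.opNorm_le_bound _ (inv_pos.2 hc).le fun y => ?_
    obtain ⟨x, rfl⟩ := (Φ.wordLin (w n)).surjective y
    rw [hLA, norm_smul, Real.norm_of_nonneg (hr0 n).le, ← div_eq_inv_mul, le_div_iff₀ hc]
    calc r n * ‖x‖ * c = c * r n * ‖x‖ := by ring
      _ ≤ α₂ (Φ.wordLin (w n)) * ‖x‖ := by gcongr; exact hn.1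
      _ ≤ _ := α₂_mul_norm_le _ x
  obtain ⟨B, -, hB⟩ := exists_tendsto_of_eventually_mem (isCompact_closedBall _ _) hbound
  have hunit : ∀ {e : ℕ → Plane}, (∀ n, ‖e n‖ = 1) → ∃ a : Plane, ‖a‖ = 1 ∧
      Tendsto (fun n => L n (e n)) U (𝓝 (B a)) := by
    intro e he
    obtain ⟨a, ha, hea⟩ := exists_tendsto_of_eventually_mem (U := U) (p := e)
      (isCompact_sphere (0 : Plane) 1) (Eventually.of_forall fun n => by simp [he n])
    exact ⟨a, by simpa using ha, tendsto_clm_apply hB hea⟩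
  refine ⟨B, hB, ?_⟩
  choose v hv1 hv using fun n => exists_norm_apply_eq_α₂ (Φ.wordLin (w n))
  choose v' hv1' hv' using fun n => exists_norm_apply_eq_α₁ (Φ.wordLin (w n))
  have hα₁ := fun n => α₁_pos (Φ.wordLin (w n))
  have hα₂ := fun n => α₂_pos (Φ.wordLin (w n))
  obtain ⟨a, -, hBa⟩ := hunit (e := fun n => (α₂ (Φ.wordLin (w n)))⁻¹ • Φ.wordLin (w n) (v n))
    fun n => by rw [norm_smul, hv n, norm_inv, Real.norm_of_nonneg (hα₂ n).le,
      inv_mul_cancel₀ (hα₂ n).ne']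
  obtain ⟨b, hb1, hBb⟩ := hunit (e := fun n => (α₁ (Φ.wordLin (w n)))⁻¹ • Φ.wordLin (w n) (v' n))
    fun n => by rw [norm_smul, hv' n, norm_inv, Real.norm_of_nonneg (hα₁ n).le,
      inv_mul_cancel₀ (hα₁ n).ne']
  simp only [map_smul, hLA] at hBa hBb
  -- The direction of the smaller singular value is not contracted by `r n • A⁻¹`.
  have hBa0 : B a ≠ 0 := by
    have : 1 ≤ ‖B a‖ := by
      refine ge_of_tendsto hBa.norm ?_
      filter_upwards [hw] with n hn
      rw [norm_smul, norm_smul, hv1 n, norm_inv, Real.norm_of_nonneg (hα₂ n).le,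
        Real.norm_of_nonneg (hr0 n).le, mul_one, ← div_eq_inv_mul, one_le_div (hα₂ n)]
      exact hn.2
    exact norm_pos_iff.1 (one_pos.trans_le this)
  -- The direction of the larger singular value is contracted by `r n / α₁ ≤ (C / c) τ ^ |w n|`.
  have hBb0 : B b = 0 := by
    obtain ⟨C, τ, hC, hτ0, hτ1, hCτ⟩ := hdom
    obtain ⟨d, hd0, hd1, hd⟩ := Φ.exists_α₂_lower_bound
    have hlen : Tendsto (fun n => (w n).length) U atTop := by
      refine tendsto_atTop.2 fun m => ?_
      filter_upwards [hw, hr.eventually_lt_const (pow_pos hd0 m)] with n hn hrn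
      by_contra! hlt
      have h1 := Φ.pow_length_le_α₂ hd0.le hd (w n)
      have h2 := pow_le_pow_of_le_one hd0.le hd1.le hlt.le
      linarith [hn.2]
    have hlim : Tendsto (fun n => C / c * τ ^ (w n).length) U (𝓝 0) := by
      simpa using ((tendsto_pow_atTop_nhds_zero_of_lt_one hτ0.le hτ1).comp hlen).const_mul (C / c)
    refine tendsto_nhds_unique hBb (squeeze_zero_norm' ?_ hlim)
    filter_upwards [hw] with n hn
    rw [norm_smul, norm_smul, hv1' n, norm_inv, Real.norm_of_nonneg (hα₁ n).le,
      Real.norm_of_nonneg (hr0 n).le, mul_one, ← div_eq_inv_mul, div_le_iff₀ (hα₁ n),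
      div_mul_eq_mul_div, div_mul_eq_mul_div, le_div_iff₀ hc, mul_comm (r n)]
    exact hn.1.trans (hCτ (w n))
  have h := (B : Plane →ₗ[ℝ] Plane).finrank_range_add_finrank_ker
  rw [finrank_euclideanSpace_fin] at h
  have h1 : 0 < Module.finrank ℝ (LinearMap.range (B : Plane →ₗ[ℝ] Plane)) := by
    rw [Module.finrank_pos_iff_exists_ne_zero]
    exact ⟨⟨B a, a, rfl⟩, fun h => hBa0 (congrArg Subtype.val h)⟩
  have h2 : 0 < Module.finrank ℝ (LinearMap.ker (B : Plane →ₗ[ℝ] Plane)) := by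
    rw [Module.finrank_pos_iff_exists_ne_zero]
    refine ⟨⟨b, hBb0⟩, fun h => ?_⟩
    have : b = 0 := congrArg Subtype.val h
    simp [this] at hb1
  omega

/-- The part of a tangent set carried by the cylinders `φ_{w n}(X)`: the limits along `U` of points
`q n` of the unit ball such that `x n + r n • q n` lies in `φ_{w n}(X)`. -/
def cylinderLimit (Φ : AffineIFS N) (X : Set Plane) (U : Ultrafilter ℕ) (x : ℕ → Plane) (r : ℕ → ℝ)
    (w : ℕ → List (Fin N)) : Set Plane :=
  {t | ∃ p q : ℕ → Plane, (∀ᶠ n in (U : Filter ℕ), p n ∈ X ∧ q n ∈ closedBall (0 : Plane) 1 ∧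
      Φ.wordMap (w n) (p n) = x n + r n • q n) ∧ Tendsto q U (𝓝 t)}

/-- The part of a tangent carried by one sequence of cylinders lies in a tube over a slice of `X` in a
backward Furstenberg direction. -/
theorem exists_dimH_cylinderLimit_le [NeZero N] (hdom : Φ.IsDominated) {X : Set Plane}
    (hX : IsCompact X) {U : Ultrafilter ℕ} {w : ℕ → List (Fin N)} {x : ℕ → Plane} {r : ℕ → ℝ}
    (hr0 : ∀ n, 0 < r n) (hr : Tendsto r U (𝓝 0)) {c : ℝ} (hc : 0 < c)
    (hw : ∀ᶠ n in (U : Filter ℕ),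
      c * r n ≤ α₂ (Φ.wordLin (w n)) ∧ α₂ (Φ.wordLin (w n)) ≤ r n)
    (hne : (Φ.cylinderLimit X U x r w).Nonempty) :
    ∃ y ∈ X, ∃ V ∈ Φ.backwardFurstenberg,
      dimH (Φ.cylinderLimit X U x r w) ≤
        1 + dimH (X ∩ translate (V : Set Plane) y) := by
  obtain ⟨B, hB, hrank⟩ := exists_rank_one_limit hdom hr0 hr hc hw
  have hlim : ∀ t : Plane, ∃ (p : ℕ → Plane) (q : ℕ → Plane) (y : Plane),
      t ∈ Φ.cylinderLimit X U x r w → (∀ᶠ n in (U : Filter ℕ), q n ∈ closedBall (0 : Plane) 1 ∧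
        Φ.wordMap (w n) (p n) = x n + r n • q n) ∧
      Tendsto q U (𝓝 t) ∧ Tendsto p U (𝓝 y) ∧ y ∈ X := by
    intro t
    by_cases ht : t ∈ Φ.cylinderLimit X U x r w
    · obtain ⟨p, q, hpq, hq⟩ := ht
      obtain ⟨y, hy, hpy⟩ := exists_tendsto_of_eventually_mem hX (hpq.mono fun n h => h.1)
      exact ⟨p, q, y, fun _ => ⟨hpq.mono fun n h => h.2, hq, hpy, hy⟩⟩
    · exact ⟨0, 0, 0, fun h => absurd h ht⟩
  choose p q y hpqy using hlim
  have hdiff : ∀ t ∈ Φ.cylinderLimit X U x r w, ∀ s ∈ Φ.cylinderLimit X U x r w,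
      y t - y s = B (t - s) := by
    intro t ht s hs
    obtain ⟨h1, h2, h3, -⟩ := hpqy t ht
    obtain ⟨h4, h5, h6, -⟩ := hpqy s hs
    refine tendsto_nhds_unique (h3.sub h6) ((tendsto_clm_apply hB (h2.sub h5)).congr' ?_)
    filter_upwards [h1, h4] with n hn hn'
    have hsub := Φ.wordMap_sub (w n) (p t n) (p s n)
    rw [hn.2, hn'.2, add_sub_add_left_eq_sub, ← smul_sub] at hsub
    rw [_root_.smul_apply, ← map_smul, hsub]
    exact (Φ.wordLin (w n)).symm_apply_apply _
  obtain ⟨t₀, ht₀⟩ := hne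
  refine ⟨y t₀, (hpqy t₀ ht₀).2.2.2, LinearMap.range (B : Plane →ₗ[ℝ] Plane),
    ⟨B, ?_, hrank, rfl⟩, ?_⟩
  · refine mem_closure_of_tendsto hB (Eventually.of_forall fun n => ⟨r n, (w n).reverse, ?_⟩)
    rw [List.reverse_reverse]
  · refine dimH_le_one_add_dimH_of_rank_one hrank ?_ hdiff fun t ht => ⟨(hpqy t ht).2.2.2, ?_⟩
    · intro t ht
      obtain ⟨h1, h2, -, -⟩ := hpqy t ht
      exact isClosed_closedBall.mem_of_tendsto h2 (h1.mono fun n h => h.1)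
    · exact ⟨B (t - t₀), ⟨t - t₀, rfl⟩, by simp [← hdiff t ht t₀ ht₀]⟩

/-- `M` words whose cylinders cover `X ∩ B(x, r)`, when the neighbourhood `Φ(x, r)` has at most `M`
maps; several words may give the same map, and repetitions fill up the index set. -/
theorem exists_words_cover [NeZero N] {X : Set Plane} (hX : X = ⋃ i, Φ.map i '' X) {M : ℕ}
    {x : Plane} (hx : x ∈ X) {r : ℝ} (hr0 : 0 < r) (hr1 : r < 1)
    (hM : (Φ.neighborhood X x r).encard ≤ M) :
    ∃ g : Fin M → List (Fin N), (∀ j, g j ≠ [] ∧ α₂ (Φ.wordLin (g j)) ≤ r ∧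
        r < α₂ (Φ.wordLin (g j).dropLast)) ∧
      ∀ y ∈ X ∩ closedBall x r, ∃ j, y ∈ Φ.wordMap (g j) '' X := by
  have hmem : ∀ y ∈ X ∩ closedBall x r, ∃ f ∈ Φ.neighborhood X x r, y ∈ f '' X := by
    intro y hy
    obtain ⟨w, hw0, hw1, hw2, hyw⟩ := Φ.exists_mem_wordMap_image_of_lt_one hX hy.1 hr0 hr1
    exact ⟨_, ⟨w, hw0, rfl, hw1, hw2, y, hyw, hy.2⟩, hyw⟩
  have hfin : (Φ.neighborhood X x r).Finite := finite_of_encard_le_coe hM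
  have : Finite (Φ.neighborhood X x r) := hfin
  have : Fintype (Φ.neighborhood X x r) := Fintype.ofFinite _
  have : Nonempty (Φ.neighborhood X x r) := by
    obtain ⟨f, hf, -⟩ := hmem x ⟨hx, mem_closedBall_self hr0.le⟩
    exact ⟨⟨f, hf⟩⟩
  have hcard : Fintype.card (Φ.neighborhood X x r) ≤ Fintype.card (Fin M) := by
    rw [Fintype.card_fin, ← Nat.card_eq_fintype_card, Nat.card_coe_set_eq]
    rw [← hfin.cast_ncard_eq] at hM
    exact_mod_cast hM
  obtain ⟨e⟩ := Function.Embedding.nonempty_of_card_le hcard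
  have hsurj := Function.invFun_surjective e.injective
  choose g hg using fun j : Fin M => (Function.invFun e j).2
  refine ⟨g, fun j => ⟨(hg j).1, (hg j).2.2.1, (hg j).2.2.2.1⟩, fun y hy => ?_⟩
  obtain ⟨f, hf, hyf⟩ := hmem y hy
  obtain ⟨j, hj⟩ := hsurj ⟨f, hf⟩
  exact ⟨j, by rw [← (hg j).2.1, hj]; exact hyf⟩

/-- Every weak tangent is bounded in dimension by one plus the dimension of a slice of `X`. -/
theorem exists_dimH_weakTangent_le {X : Set Plane} (hX : Φ.IsLimitSet X) (hdom : Φ.IsDominated)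
    (hW : Φ.WBNC X) {T : Set Plane} (hT : IsWeakTangent X T) :
    ∃ x ∈ X, ∃ V ∈ Φ.backwardFurstenberg,
      dimH T ≤ 1 + dimH (X ∩ translate (V : Set Plane) x) := by
  obtain ⟨hXne, hXc, hXeq⟩ := hX
  have : NeZero N := by
    refine ⟨fun h => ?_⟩
    subst h
    rw [hXeq] at hXne
    simp at hXne
  obtain ⟨⟨t₁, ht₁, -⟩, x, r, hxX, hr0, hr, hlim⟩ := hT
  obtain ⟨M, hM⟩ := hW
  have hUle : ((hyperfilter ℕ : Ultrafilter ℕ) : Filter ℕ) ≤ atTop := Nat.hyperfilter_le_atTop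
  set U : Ultrafilter ℕ := hyperfilter ℕ
  have hrU : Tendsto r U (𝓝 0) := hr.mono_left hUle
  have hr1 : ∀ᶠ n in (U : Filter ℕ), r n < 1 := hrU.eventually_lt_const one_pos
  have hg : ∀ n, ∃ g : Fin M → List (Fin N), r n < 1 →
      (∀ j, g j ≠ [] ∧ α₂ (Φ.wordLin (g j)) ≤ r n ∧ r n < α₂ (Φ.wordLin (g j).dropLast)) ∧
      ∀ y ∈ X ∩ closedBall (x n) (r n), ∃ j, y ∈ Φ.wordMap (g j) '' X := by
    intro n
    by_cases h : r n < 1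
    · obtain ⟨g, hg⟩ := exists_words_cover hXeq (hxX n) (hr0 n) h (hM _ (hxX n) _ (hr0 n))
      exact ⟨g, fun _ => hg⟩
    · exact ⟨fun _ => [], fun h' => absurd h' h⟩
  choose g hg using hg
  have hTsub : T ⊆ ⋃ j, Φ.cylinderLimit X U x r fun n => g n j := by
    intro t ht
    have hS : ∀ n, ∃ q ∈ magnify (x n) (r n) '' X ∩ closedBall (0 : Plane) 1,
        infEDist t (magnify (x n) (r n) '' X ∩ closedBall (0 : Plane) 1) = edist t q := by
      intro n
      have h0 : (0 : Plane) ∈ magnify (x n) (r n) '' X ∩ closedBall (0 : Plane) 1 :=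
        ⟨⟨x n, hxX n, by simp [magnify]⟩, by simp⟩
      refine IsCompact.exists_infEDist_eq_edist ?_ ⟨0, h0⟩ t
      refine (hXc.image ?_).inter_right isClosed_closedBall
      unfold magnify
      fun_prop
    choose q hq hqt using hS
    have hqlim : Tendsto q U (𝓝 t) := by
      rw [tendsto_iff_edist_tendsto_0]
      refine tendsto_of_tendsto_of_tendsto_of_le_of_le tendsto_const_nhds (hlim.mono_left hUle)
        (fun _ => zero_le) fun n => ?_
      rw [edist_comm, ← hqt n, hausdorffEDist_comm]
      exact infEDist_le_hausdorffEDist_of_mem ht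
    have hj : ∀ᶠ n in (U : Filter ℕ), ∃ j, ∃ p ∈ X, Φ.wordMap (g n j) p = x n + r n • q n := by
      filter_upwards [hr1] with n hn
      obtain ⟨⟨z, hz, hzq⟩, hq1⟩ := hq n
      have hzq' : z = x n + r n • q n := by
        rw [← hzq, magnify, smul_smul, mul_inv_cancel₀ (hr0 n).ne', one_smul, add_sub_cancel]
      obtain ⟨j, p, hp, hpz⟩ := (hg n hn).2 z ⟨hz, by
        rw [hzq', mem_closedBall, dist_self_add_left, norm_smul, Real.norm_of_nonneg (hr0 n).le]
        exact mul_le_of_le_one_right (hr0 n).le (by simpa using hq1)⟩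
      exact ⟨j, p, hp, by rw [hpz, hzq']⟩
    -- The ultrafilter selects one index `j` for almost all `n`.
    obtain ⟨j, hj⟩ := Ultrafilter.eventually_exists_iff.1 hj
    have hp : ∀ n, ∃ p, (∃ p ∈ X, Φ.wordMap (g n j) p = x n + r n • q n) →
        p ∈ X ∧ Φ.wordMap (g n j) p = x n + r n • q n := by
      intro n
      by_cases h : ∃ p ∈ X, Φ.wordMap (g n j) p = x n + r n • q n
      · obtain ⟨p, hp⟩ := h
        exact ⟨p, fun _ => hp⟩
      · exact ⟨0, fun h' => absurd h' h⟩
    choose p hp using hp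
    refine mem_iUnion.2 ⟨j, p, q, hj.mono fun n hn => ?_, hqlim⟩
    exact ⟨(hp n hn).1, (hq n).2, (hp n hn).2⟩
  obtain ⟨j₁, hj₁⟩ := mem_iUnion.1 (hTsub ht₁)
  have : Nonempty (Fin M) := ⟨j₁⟩
  obtain ⟨j₀, hj₀⟩ := Finite.exists_max fun j => dimH (Φ.cylinderLimit X U x r fun n => g n j)
  have hTj : dimH T ≤ dimH (Φ.cylinderLimit X U x r fun n => g n j₀) := by
    refine (dimH_mono hTsub).trans ?_
    rw [dimH_iUnion]
    exact iSup_le hj₀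
  obtain ⟨c, hc0, -, hc⟩ := Φ.exists_α₂_lower_bound
  have hgj : ∀ j, ∀ᶠ n in (U : Filter ℕ),
      c * r n ≤ α₂ (Φ.wordLin (g n j)) ∧ α₂ (Φ.wordLin (g n j)) ≤ r n := by
    intro j
    filter_upwards [hr1] with n hn
    obtain ⟨h1, h2, h3⟩ := (hg n hn).1 j
    exact ⟨(mul_le_mul_of_nonneg_left h3.le hc0.le).trans (Φ.mul_α₂_dropLast_le hc h1), h2⟩
  -- If the part of largest dimension is empty, then `dimH T = 0`, and the slice coming from any
  -- non-empty part will do.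
  rcases (Φ.cylinderLimit X U x r fun n => g n j₀).eq_empty_or_nonempty with hemp | hne
  · obtain ⟨y, hy, V, hV, -⟩ :=
      exists_dimH_cylinderLimit_le hdom hXc hr0 hrU hc0 (hgj j₁) ⟨t₁, hj₁⟩
    refine ⟨y, hy, V, hV, hTj.trans ?_⟩
    rw [hemp, dimH_empty]
    exact zero_le
  · obtain ⟨y, hy, V, hV, hle⟩ := exists_dimH_cylinderLimit_le hdom hXc hr0 hrU hc0 (hgj j₀) hne
    exact ⟨y, hy, V, hV, hTj.trans hle⟩

end AffineIFS

end SelfAffine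

/-! ### Assouad dimension from weak tangents -/

namespace SelfAffine

/-- A finite family of balls centred in `X`, recorded as pairs (centre, relative radius), which
covers `X ∩ B(x, R)` by balls `B(p.1, p.2 * R)` with relative radii in `[ρ, 1/2]` and
`∑ p.2 ^ s ≤ 1`. -/
def IsEfficientCover (X : Set Plane) (s ρ : ℝ) (x : Plane) (R : ℝ)
    (F : Finset (Plane × ℝ)) : Prop :=
  (∀ p ∈ F, p.1 ∈ X ∧ ρ ≤ p.2 ∧ p.2 ≤ 1 / 2) ∧
    X ∩ closedBall x R ⊆ ⋃ p ∈ F, closedBall p.1 (p.2 * R) ∧ ∑ p ∈ F, p.2 ^ s ≤ 1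

/-- Iterating efficient covers until the radii are at most `r` gives boundedly many balls: the sum of
`radius ^ s` does not increase, and no radius drops below `ρ * r`. The induction is on the number of
halvings needed to pass from `R` to `r`. -/
theorem exists_finset_cover_of_efficientCover {X : Set Plane} {s ρ R₀ : ℝ} (hs : 0 < s)
    (hρ : 0 < ρ) (h : ∀ x ∈ X, ∀ R, 0 < R → R < R₀ → ∃ F, IsEfficientCover X s ρ x R F)
    {r : ℝ} (hr : 0 < r) (n : ℕ) :
    ∀ x ∈ X, ∀ R, ρ * r ≤ R → R < R₀ → R ≤ 2 ^ n * r → ∃ C : Finset Plane,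
      X ∩ closedBall x R ⊆ ⋃ c ∈ C, closedBall c r ∧ (C.card : ℝ) * (ρ * r) ^ s ≤ R ^ s := by
  have hsmall : ∀ x R, ρ * r ≤ R → R ≤ r → ∃ C : Finset Plane,
      X ∩ closedBall x R ⊆ ⋃ c ∈ C, closedBall c r ∧ (C.card : ℝ) * (ρ * r) ^ s ≤ R ^ s := by
    intro x R h1 h2
    refine ⟨{x}, ?_, ?_⟩
    · simpa using inter_subset_right.trans (closedBall_subset_closedBall h2)
    -- A single ball suffices, and `ρ * r ≤ R` makes it count at most `R ^ s`.
    · simpa using Real.rpow_le_rpow (by positivity) h1 hs.le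
  induction n with
  | zero =>
    intro x _ R h1 _ h2
    exact hsmall x R h1 (by simpa using h2)
  | succ n ih =>
    intro x hx R h1 hR h2
    rcases le_or_gt R r with hRr | hRr
    · exact hsmall x R h1 hRr
    have hR0 : 0 < R := hr.trans hRr
    obtain ⟨F, hF, hcov, hsum⟩ := h x hx R hR0 hR
    have hsub : ∀ p : Plane × ℝ, ∃ C : Finset Plane, p ∈ F →
        X ∩ closedBall p.1 (p.2 * R) ⊆ ⋃ c ∈ C, closedBall c r ∧
          (C.card : ℝ) * (ρ * r) ^ s ≤ (p.2 * R) ^ s := by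
      intro p
      by_cases hp : p ∈ F
      · obtain ⟨hp1, hp2, hp3⟩ := hF p hp
        have e0 : 0 ≤ p.2 := hρ.le.trans hp2
        have e1 : p.2 * R ≤ 1 / 2 * R := by gcongr
        obtain ⟨C, hC⟩ := ih p.1 hp1 (p.2 * R) (by gcongr) (by linarith)
          (by rw [pow_succ] at h2; linarith)
        exact ⟨C, fun _ => hC⟩
      · exact ⟨∅, fun h => absurd h hp⟩
    choose C hC using hsub
    classical
    refine ⟨F.biUnion C, ?_, ?_⟩
    · intro y hy
      obtain ⟨p, hp, hyp⟩ := mem_iUnion₂.1 (hcov hy)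
      obtain ⟨c, hc, hyc⟩ := mem_iUnion₂.1 ((hC p hp).1 ⟨hy.1, hyp⟩)
      exact mem_iUnion₂.2 ⟨c, Finset.mem_biUnion.2 ⟨p, hp, hc⟩, hyc⟩
    · have hcard : ((F.biUnion C).card : ℝ) ≤ ∑ p ∈ F, ((C p).card : ℝ) := by
        exact_mod_cast Finset.card_biUnion_le
      calc ((F.biUnion C).card : ℝ) * (ρ * r) ^ s
          ≤ (∑ p ∈ F, ((C p).card : ℝ)) * (ρ * r) ^ s := by gcongr
        _ = ∑ p ∈ F, ((C p).card : ℝ) * (ρ * r) ^ s := Finset.sum_mul _ _ _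
        _ ≤ ∑ p ∈ F, p.2 ^ s * R ^ s := by
            refine Finset.sum_le_sum fun p hp => (hC p hp).2.trans_eq ?_
            exact Real.mul_rpow (hρ.le.trans (hF p hp).2.1) hR0.le
        _ = (∑ p ∈ F, p.2 ^ s) * R ^ s := (Finset.sum_mul _ _ _).symm
        _ ≤ 1 * R ^ s := by gcongr
        _ = R ^ s := one_mul _

theorem externalCoveringNumber_le_card {A : Set Plane} {r : ℝ≥0} {C : Finset Plane}
    (h : A ⊆ ⋃ c ∈ C, closedBall c (r : ℝ)) :
    externalCoveringNumber r A ≤ C.card := by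
  refine (IsCover.externalCoveringNumber_le_encard (C := (C : Set Plane)) fun y hy => ?_).trans
    (encard_coe_eq_coe_finsetCard C).le
  obtain ⟨c, hc, hyc⟩ := mem_iUnion₂.1 (h hy)
  refine ⟨c, hc, ?_⟩
  simpa [edist_dist, ENNReal.ofReal_le_iff_le_toReal] using hyc

theorem assouadDim_le_of_efficientCover {X : Set Plane} (hX : IsCompact X) {s : ℝ≥0} (hs : 0 < s)
    {ρ R₀ : ℝ} (hρ : 0 < ρ) (hρ1 : ρ ≤ 1) (hR₀ : 0 < R₀)
    (h : ∀ x ∈ X, ∀ R, 0 < R → R < R₀ → ∃ F, IsEfficientCover X s ρ x R F) :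
    assouadDim X ≤ s := by
  have hs' : (0 : ℝ) < s := hs
  obtain ⟨D, hDX, hD, hDcov⟩ := hX.finite_cover_balls (half_pos hR₀)
  lift D to Finset Plane using hD
  have hlocal : ∀ x ∈ X, ∀ r R : ℝ, 0 < r → r ≤ R → R < R₀ → ∃ C : Finset Plane,
      X ∩ closedBall x R ⊆ ⋃ c ∈ C, closedBall c r ∧
        (C.card : ℝ) ≤ ρ ^ (-(s : ℝ)) * (R / r) ^ (s : ℝ) := by
    intro x hx r R hr hrR hR
    obtain ⟨n, hn⟩ := pow_unbounded_of_one_lt (R / r) one_lt_two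
    obtain ⟨C, hC, hcard⟩ := exists_finset_cover_of_efficientCover hs' hρ h hr n x hx R
      ((mul_le_of_le_one_left hr.le hρ1).trans hrR) hR ((div_le_iff₀ hr).1 hn.le)
    refine ⟨C, hC, ?_⟩
    rw [Real.rpow_neg hρ.le, Real.div_rpow (hr.le.trans hrR) hr.le, ← div_eq_inv_mul, div_div,
      le_div_iff₀ (by positivity), mul_comm ((r : ℝ) ^ (s : ℝ)), ← Real.mul_rpow hρ.le hr.le]
    exact hcard
  -- The factor `D.card` accounts for radii `R ≥ R₀`, where `X` is first covered by the balls of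
  -- radius `R₀ / 2` centred in `D`.
  set Q : ℝ≥0 := (D.card + 1) * (ρ.toNNReal ^ (-(s : ℝ)) + 1) with hQ
  have hQr : (Q : ℝ) = (D.card + 1) * (ρ ^ (-(s : ℝ)) + 1) := by
    simp [hQ, Real.coe_toNNReal _ hρ.le]
  refine iInf₂_le s ⟨hs, Q, by positivity, fun x hx r R hr hrR => ?_⟩
  have hr' : (0 : ℝ) < r := hr
  have hrR' : (r : ℝ) < R := hrR
  have hR' : (0 : ℝ) < R := hr'.trans hrR'
  suffices hC : ∃ C : Finset Plane, X ∩ closedBall x R ⊆ ⋃ c ∈ C, closedBall c (r : ℝ) ∧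
      (C.card : ℝ) ≤ Q * ((R : ℝ) / r) ^ (s : ℝ) by
    obtain ⟨C, hC, hcard⟩ := hC
    have h1 := externalCoveringNumber_le_card hC
    calc ((externalCoveringNumber r (X ∩ closedBall x R) : ℕ∞) : ℝ≥0∞)
        ≤ ((C.card : ℕ∞) : ℝ≥0∞) := by exact_mod_cast h1
      _ = ((C.card : ℝ≥0) : ℝ≥0∞) := by simp
      _ ≤ _ := by
        rw [ENNReal.coe_le_coe, ← NNReal.coe_le_coe]
        push_cast
        exact hcard
  have hp : 0 ≤ ρ ^ (-(s : ℝ)) := by positivity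
  have hD0 : (0 : ℝ) ≤ D.card := by positivity
  have hone : 1 ≤ ((R : ℝ) / r) ^ (s : ℝ) :=
    Real.one_le_rpow ((one_le_div hr').2 hrR'.le) hs'.le
  rcases lt_or_ge (R : ℝ) R₀ with hRlt | hRge
  · obtain ⟨C, hC, hcard⟩ := hlocal x hx r R hr' hrR'.le hRlt
    refine ⟨C, hC, hcard.trans ?_⟩
    rw [hQr]
    gcongr
    nlinarith
  rcases lt_or_ge (r : ℝ) (R₀ / 2) with hrlt | hrge
  · have hsub : ∀ d : Plane, ∃ C : Finset Plane, d ∈ D →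
        X ∩ closedBall d (R₀ / 2) ⊆ ⋃ c ∈ C, closedBall c (r : ℝ) ∧
          (C.card : ℝ) ≤ ρ ^ (-(s : ℝ)) * ((R : ℝ) / r) ^ (s : ℝ) := by
      intro d
      by_cases hd : d ∈ D
      · obtain ⟨C, hC, hcard⟩ := hlocal d (hDX hd) r (R₀ / 2) hr' hrlt.le (half_lt_self hR₀)
        refine ⟨C, fun _ => ⟨hC, hcard.trans ?_⟩⟩
        gcongr
        linarith
      · exact ⟨∅, fun h => absurd h hd⟩
    choose C hC using hsub
    classical
    refine ⟨D.biUnion C, ?_, ?_⟩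
    · intro y hy
      obtain ⟨d, hd, hyd⟩ := mem_iUnion₂.1 (hDcov hy.1)
      obtain ⟨c, hc, hyc⟩ := mem_iUnion₂.1 ((hC d hd).1 ⟨hy.1, ball_subset_closedBall hyd⟩)
      exact mem_iUnion₂.2 ⟨c, Finset.mem_biUnion.2 ⟨d, hd, hc⟩, hyc⟩
    · calc ((D.biUnion C).card : ℝ) ≤ ∑ d ∈ D, ((C d).card : ℝ) := by
            exact_mod_cast Finset.card_biUnion_le
        _ ≤ ∑ d ∈ D, ρ ^ (-(s : ℝ)) * ((R : ℝ) / r) ^ (s : ℝ) :=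
            Finset.sum_le_sum fun d hd => (hC d hd).2
        _ = (D.card * ρ ^ (-(s : ℝ))) * ((R : ℝ) / r) ^ (s : ℝ) := by
            rw [Finset.sum_const, nsmul_eq_mul, mul_assoc]
        _ ≤ Q * ((R : ℝ) / r) ^ (s : ℝ) := by
            rw [hQr]
            gcongr
            · linarith
            · linarith
  · refine ⟨D, fun y hy => ?_, ?_⟩
    · obtain ⟨d, hd, hyd⟩ := mem_iUnion₂.1 (hDcov hy.1)
      exact mem_iUnion₂.2 ⟨d, hd, ball_subset_closedBall (ball_subset_ball hrge hyd)⟩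
    · rw [hQr]
      nlinarith [mul_nonneg hD0 hp, mul_nonneg (by positivity : 0 ≤ ((D.card : ℝ) + 1) *
        (ρ ^ (-(s : ℝ)) + 1)) (sub_nonneg.2 hone)]

/-- Magnifications of a compact set have Hausdorff convergent subsequences, and the limits are weak
tangents. -/
theorem exists_isWeakTangent_subseq {X : Set Plane} (hX : IsCompact X) {x : ℕ → Plane} {r : ℕ → ℝ}
    (hx : ∀ n, x n ∈ X) (hr0 : ∀ n, 0 < r n) (hr : Tendsto r atTop (𝓝 0)) :
    ∃ (T : Set Plane) (φ : ℕ → ℕ), IsCompact T ∧ IsWeakTangent X T ∧ StrictMono φ ∧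
      Tendsto (fun n => hausdorffEDist
        (magnify (x (φ n)) (r (φ n)) '' X ∩ closedBall (0 : Plane) 1) T) atTop (𝓝 0) := by
  set S : ℕ → Set Plane := fun n => magnify (x n) (r n) '' X ∩ closedBall (0 : Plane) 1
  have hSc : ∀ n, IsCompact (S n) := fun n => by
    refine (hX.image ?_).inter_right isClosed_closedBall
    unfold magnify
    fun_prop
  have hS0 : ∀ n, (0 : Plane) ∈ S n := fun n => ⟨⟨x n, hx n, by simp [magnify]⟩, by simp⟩
  have : CompactSpace (closedBall (0 : Plane) 1) :=
    isCompact_iff_compactSpace.1 (isCompact_closedBall _ _)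
  let K : ℕ → TopologicalSpace.NonemptyCompacts (closedBall (0 : Plane) 1) := fun n =>
    ⟨⟨Subtype.val ⁻¹' S n,
      ((hSc n).isClosed.preimage continuous_subtype_val).isCompact⟩, ⟨0, by simp⟩, hS0 n⟩
  obtain ⟨L, φ, hφ, hL⟩ := CompactSpace.tendsto_subseq K
  have himg : ∀ n, Subtype.val '' (K n : Set (closedBall (0 : Plane) 1)) = S n := fun n => by
    change Subtype.val '' (Subtype.val ⁻¹' S n) = S n
    rw [Subtype.image_preimage_coe]
    exact inter_eq_right.2 fun y hy => hy.2
  have hlim : Tendsto (fun n => hausdorffEDist (S (φ n))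
      (Subtype.val '' (L : Set (closedBall (0 : Plane) 1)))) atTop (𝓝 0) := by
    refine (tendsto_iff_edist_tendsto_0.1 hL).congr fun n => ?_
    rw [← himg, hausdorffEDist_image isometry_subtype_coe]
    rfl
  have hTc : IsCompact (Subtype.val '' (L : Set (closedBall (0 : Plane) 1))) :=
    L.isCompact.image continuous_subtype_val
  refine ⟨_, φ, hTc, ⟨⟨0, ?_, ?_⟩, fun n => x (φ n), fun n => r (φ n), fun n => hx _, fun n => hr0 _,
    hr.comp hφ.tendsto_atTop, hlim⟩, hφ, hlim⟩
  · rw [← hTc.isClosed.closure_eq, mem_closure_iff_infEDist_zero]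
    refine le_antisymm (ge_of_tendsto hlim (Eventually.of_forall fun n => ?_)) zero_le
    exact infEDist_le_hausdorffEDist_of_mem (hS0 _)
  · rw [interior_closedBall _ one_ne_zero]
    exact mem_ball_self one_pos

/-- A cover of a magnification by balls of radii `a j` becomes an efficient cover after recentring the
balls at points of `X`, which doubles the radii. -/
theorem exists_efficientCover_of_cover {X : Set Plane} {x : Plane} {R : ℝ} (hR : 0 < R)
    {s ρ : ℝ} {ι : Type} {J : Finset ι} {c : ι → Plane} {a : ι → ℝ}
    (hcov : magnify x R '' X ∩ closedBall 0 1 ⊆ ⋃ j ∈ J, ball (c j) (a j))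
    (ha : ∀ j ∈ J, ρ ≤ 2 * a j ∧ 0 < a j ∧ a j ≤ 1 / 4) (hsum : ∑ j ∈ J, (2 * a j) ^ s ≤ 1) :
    ∃ F, IsEfficientCover X s ρ x R F := by
  classical
  set J' := J.filter fun j => ∃ y ∈ X, magnify x R y ∈ ball (c j) (a j)
  have hy : ∀ j, ∃ y, j ∈ J' → y ∈ X ∧ magnify x R y ∈ ball (c j) (a j) := by
    intro j
    by_cases h : j ∈ J'
    · obtain ⟨y, hy⟩ := (Finset.mem_filter.1 h).2
      exact ⟨y, fun _ => hy⟩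
    · exact ⟨0, fun h' => absurd h' h⟩
  choose y hy using hy
  refine ⟨J'.image fun j => (y j, 2 * a j), ?_, ?_, ?_⟩
  · intro p hp
    obtain ⟨j, hj, rfl⟩ := Finset.mem_image.1 hp
    have := ha j (Finset.mem_filter.1 hj).1
    exact ⟨(hy j hj).1, this.1, by simp only; linarith⟩
  · rintro z ⟨hzX, hz⟩
    have hzm : magnify x R z ∈ closedBall (0 : Plane) 1 := by
      rw [mem_closedBall_zero_iff, magnify, norm_smul, norm_inv, Real.norm_of_nonneg hR.le,
        ← div_eq_inv_mul, div_le_one hR, ← dist_eq_norm]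
      exact hz
    obtain ⟨j, hj, hzj⟩ := mem_iUnion₂.1 (hcov ⟨mem_image_of_mem _ hzX, hzm⟩)
    have hj' : j ∈ J' := Finset.mem_filter.2 ⟨hj, z, hzX, hzj⟩
    refine mem_iUnion₂.2 ⟨_, Finset.mem_image_of_mem _ hj', ?_⟩
    have h1 := dist_triangle_right (magnify x R z) (magnify x R (y j)) (c j)
    have h2 := mem_ball.1 hzj
    have h3 := mem_ball.1 (hy j hj').2
    have h4 : dist (magnify x R z) (magnify x R (y j)) = dist z (y j) / R := by
      rw [magnify, magnify, dist_smul₀, norm_inv, Real.norm_of_nonneg hR.le, dist_sub_right,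
        div_eq_inv_mul]
    rw [h4] at h1
    rw [mem_closedBall, ← div_le_iff₀ hR]
    linarith
  · have h0 : ∀ j ∈ J, 0 ≤ (2 * a j) ^ s := fun j hj => by
      have := (ha j hj).2.1
      positivity
    calc ∑ p ∈ J'.image fun j => (y j, 2 * a j), p.2 ^ s
        ≤ ∑ j ∈ J', (2 * a j) ^ s :=
          Finset.sum_image_le_of_nonneg fun p hp => by
            obtain ⟨j, hj, rfl⟩ := Finset.mem_image.1 hp
            exact h0 j (Finset.mem_filter.1 hj).1
      _ ≤ ∑ j ∈ J, (2 * a j) ^ s :=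
          Finset.sum_le_sum_of_subset_of_nonneg (Finset.filter_subset _ _) fun j hj _ => h0 j hj
      _ ≤ 1 := hsum

theorem exists_finset_ball_cover {T : Set Plane} (hT : IsCompact T) {s : ℝ≥0}
    (hTs : dimH T < s) :
    ∃ (J : Finset ℕ) (c : ℕ → Plane) (a : ℕ → ℝ), T ⊆ ⋃ j ∈ J, ball (c j) (a j) ∧
      (∀ j, 0 < a j ∧ a j ≤ 1 / 4) ∧ ∑ j ∈ J, (2 * a j) ^ (s : ℝ) ≤ 1 := by
  have hs : (0 : ℝ) < s := by
    have : (0 : ℝ≥0∞) < s := lt_of_le_of_lt zero_le hTs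
    exact_mod_cast this
  borelize Plane
  -- This choice forces all radii to be at most `1 / 4` and leaves room for doubling them.
  set ε : ℝ := (1 / 4) ^ (s : ℝ) with hε
  have hε0 : 0 < ε := by positivity
  obtain ⟨c, a, ha0, hcov, hsum⟩ := exists_ball_cover_of_hausdorffMeasure_eq_zero hs
    (hausdorffMeasure_of_dimH_lt hTs) (ENNReal.ofReal_pos.2 hε0)
  obtain ⟨J, hJ⟩ := hT.elim_finite_subcover _ (fun _ => isOpen_ball) hcov
  have hpow : ∀ n, ENNReal.ofReal (a n) ^ (s : ℝ) = ENNReal.ofReal (a n ^ (s : ℝ)) := fun n =>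
    ENNReal.ofReal_rpow_of_pos (ha0 n)
  have hJsum : ∀ J : Finset ℕ, ∑ j ∈ J, a j ^ (s : ℝ) ≤ ε := by
    intro J
    have h := (ENNReal.sum_le_tsum J).trans hsum.le
    simp only [hpow] at h
    rw [← ENNReal.ofReal_sum_of_nonneg fun j _ => Real.rpow_nonneg (ha0 j).le _] at h
    exact (ENNReal.ofReal_le_ofReal_iff hε0.le).1 h
  refine ⟨J, c, a, hJ, fun j => ⟨ha0 j, ?_⟩, ?_⟩
  · have := hJsum {j}
    rw [Finset.sum_singleton] at this
    exact (Real.rpow_le_rpow_iff (ha0 j).le (by norm_num) hs).1 this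
  · calc ∑ j ∈ J, (2 * a j) ^ (s : ℝ) = 2 ^ (s : ℝ) * ∑ j ∈ J, a j ^ (s : ℝ) := by
          rw [Finset.mul_sum]
          exact Finset.sum_congr rfl fun j _ => Real.mul_rpow zero_le_two (ha0 j).le
      _ ≤ 2 ^ (s : ℝ) * ε := by gcongr; exact hJsum J
      _ = (1 / 2) ^ (s : ℝ) := by
          rw [hε, ← Real.mul_rpow (by norm_num) (by norm_num)]
          norm_num
      _ ≤ 1 := Real.rpow_le_one (by norm_num) (by norm_num) hs.le

theorem assouadDim_le_of_forall_weakTangent {X : Set Plane} (hX : IsCompact X) {s : ℝ≥0}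
    (hs : 0 < s) (h : ∀ T, IsWeakTangent X T → dimH T < s) : assouadDim X ≤ s := by
  by_contra hcon
  have hfail : ∀ n : ℕ, ∃ x ∈ X, ∃ R, 0 < R ∧ R < 1 / ((n : ℝ) + 1) ∧
      ∀ F, ¬ IsEfficientCover X s (1 / ((n : ℝ) + 1)) x R F := by
    intro n
    by_contra! hn
    exact hcon (assouadDim_le_of_efficientCover hX hs Nat.one_div_pos_of_nat
      (by rw [div_le_one (by positivity)]; linarith [n.cast_nonneg (α := ℝ)])
      Nat.one_div_pos_of_nat hn)
  choose x hx R hR0 hR1 hno using hfail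
  have hlim : Tendsto (fun n : ℕ => 1 / ((n : ℝ) + 1)) atTop (𝓝 0) :=
    tendsto_one_div_add_atTop_nhds_zero_nat
  have hR : Tendsto R atTop (𝓝 0) :=
    squeeze_zero (fun n => (hR0 n).le) (fun n => (hR1 n).le) hlim
  obtain ⟨T, φ, hTc, hT, hφ, hTlim⟩ := exists_isWeakTangent_subseq hX hx hR0 hR
  obtain ⟨J, c, a, hcov, ha, hsum⟩ := exists_finset_ball_cover hTc (h T hT)
  obtain ⟨δ, hδ0, hδ⟩ := hTc.exists_thickening_subset_open
    (isOpen_biUnion fun j _ => isOpen_ball) hcov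
  have hev1 := hTlim.eventually_lt_const (ENNReal.ofReal_pos.2 hδ0)
  have hev2 : ∀ᶠ n in atTop, ∀ j ∈ J, 1 / ((φ n : ℝ) + 1) < 2 * a j := by
    rw [eventually_all_finset]
    exact fun j _ => (hlim.comp hφ.tendsto_atTop).eventually_lt_const
      (mul_pos two_pos (ha j).1)
  obtain ⟨n, hn1, hn2⟩ := (hev1.and hev2).exists
  obtain ⟨F, hF⟩ := exists_efficientCover_of_cover (hR0 (φ n)) (s := s)
    (J := J) (c := c) (a := a) (ρ := 1 / ((φ n : ℝ) + 1)) (fun y hy => hδ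
      (mem_thickening_iff_infEDist_lt.2 ((infEDist_le_hausdorffEDist_of_mem hy).trans_lt hn1)))
    (fun j hj => ⟨(hn2 j hj).le, ha j⟩) hsum
  exact hno _ F hF

end SelfAffine

theorem proposition3p1 {N : ℕ} (Φ : SelfAffine.AffineIFS N) (X : Set SelfAffine.Plane)
    (hX : Φ.IsLimitSet X) (hdom : Φ.IsDominated) (hW : Φ.WBNC X) :
    (∀ T : Set SelfAffine.Plane, SelfAffine.IsWeakTangent X T →
      ∃ x ∈ X, ∃ V ∈ Φ.backwardFurstenberg,
        dimH T ≤ 1 + dimH (X ∩ SelfAffine.translate (V : Set SelfAffine.Plane) x)) ∧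
    SelfAffine.assouadDim X ≤
      1 + ⨆ x ∈ X, ⨆ V ∈ Φ.backwardFurstenberg,
        dimH (X ∩ SelfAffine.translate (V : Set SelfAffine.Plane) x) := by
  refine ⟨fun T hT => SelfAffine.AffineIFS.exists_dimH_weakTangent_le hX hdom hW hT, ?_⟩
  refine le_of_forall_gt fun s hs => ?_
  obtain ⟨s', hs1, hs2⟩ := ENNReal.lt_iff_exists_nnreal_btwn.1 hs
  refine lt_of_le_of_lt ?_ hs2
  refine SelfAffine.assouadDim_le_of_forall_weakTangent hX.2.1 ?_ fun T hT => ?_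
  · have : (0 : ℝ≥0∞) < s' := lt_of_le_of_lt zero_le hs1
    exact_mod_cast this
  · obtain ⟨x, hx, V, hV, hle⟩ := SelfAffine.AffineIFS.exists_dimH_weakTangent_le hX hdom hW hT
    refine (hle.trans ?_).trans_lt hs1
    gcongr
    exact le_iSup₂_of_le x hx (le_iSup₂_of_le V hV le_rfl)
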